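/- Let $G$ be a finite simple graph that is connected and planar and has girth at least $6$ (an acyclic graph has girth $\infty$). Then $G$ is a Gallai graph: its path number $\mathrm{pn}(G)$ is at most $\lfloor n/2\rfloor$, where $n$ is the number of non-isolated vertices of $G$ (so $n=|V(G)|$ unless $G$ has a single vertex). Here the path number of $G$ is the minimum size of a set of pairwise edge-disjoint paths in $G$ that together cover the edge set of $G$. A graph is planar if it can be drawn in the plane $\mathbb{R}^2$ with its vertices as distinct points and each edge as a polygonal arc (a non-self-intersecting chain of finitely many straight line segments) joining its ends, such that the interior of an edge contains no vertex and no point of any other edge. -/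

import Mathlib

/-- `A` is a polygonal arc in the plane joining `x` to `y`: the union of the segments of a polygonal
chain `x = p 0, p 1, …, p k = y` (with `k ≥ 1`) that does not cross or touch itself, i.e. all
segments are nondegenerate, two consecutive ones meet only in their common endpoint, and two
non-consecutive ones are disjoint. -/
def IsPolygonalArc (x y : ℝ × ℝ) (A : Set (ℝ × ℝ)) : Prop :=
  ∃ (k : ℕ) (p : ℕ → ℝ × ℝ), 1 ≤ k ∧ p 0 = x ∧ p k = y ∧
    A = ⋃ i ∈ Set.Iio k, segment ℝ (p i) (p (i + 1)) ∧
    (∀ i < k, p i ≠ p (i + 1)) ∧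
    (∀ i, i + 1 < k →
      segment ℝ (p i) (p (i + 1)) ∩ segment ℝ (p (i + 1)) (p (i + 2)) = {p (i + 1)}) ∧
    (∀ i j, i + 1 < j → j < k →
      Disjoint (segment ℝ (p i) (p (i + 1))) (segment ℝ (p j) (p (j + 1))))

namespace SimpleGraph

/-- A drawing of `G` in the plane without crossings: distinct vertices are distinct points, each
edge is an arc joining its two ends, and the interior of an edge contains no vertex and no point of
any other edge. The value of `arc` at a pair that is not an edge is irrelevant. -/
structure PlaneDrawing {V : Type*} (G : SimpleGraph V) where
  point : V → ℝ × ℝ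
  arc : Sym2 V → Set (ℝ × ℝ)
  point_injective : Function.Injective point
  isPolygonalArc : ∀ u v, G.Adj u v → IsPolygonalArc (point u) (point v) (arc s(u, v))
  mem_of_point_mem_arc : ∀ e ∈ G.edgeSet, ∀ w, point w ∈ arc e → w ∈ e
  arc_inter_arc : ∀ e ∈ G.edgeSet, ∀ f ∈ G.edgeSet, e ≠ f →
    arc e ∩ arc f ⊆ point '' {w | w ∈ e ∧ w ∈ f}

/-- A graph is planar if it can be drawn in the plane without crossings. -/
def IsPlanar {V : Type*} (G : SimpleGraph V) : Prop := Nonempty G.PlaneDrawing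

/-- A subgraph of `G` that is a path. -/
def Subgraph.IsPathSubgraph {V : Type*} {G : SimpleGraph V} (H : G.Subgraph) : Prop :=
  ∃ (u v : V) (p : G.Walk u v), p.IsPath ∧ p.toSubgraph = H

/-- A path decomposition of `G`: a finite set of pairwise edge-disjoint paths in `G` that together
cover the edge set of `G`. -/
structure IsPathDecomposition {V : Type*} (G : SimpleGraph V) (D : Finset G.Subgraph) : Prop where
  isPath : ∀ H ∈ D, H.IsPathSubgraph
  edgeDisjoint : ∀ H ∈ D, ∀ K ∈ D, H ≠ K → Disjoint H.edgeSet K.edgeSet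
  cover : ∀ e ∈ G.edgeSet, ∃ H ∈ D, e ∈ H.edgeSet

/-- The path number of `G`: the size of a minimum path decomposition. For finite graphs one
exists, see `exists_isPathDecomposition`. -/
noncomputable def pathNumber {V : Type*} (G : SimpleGraph V) : ℕ :=
  sInf {k | ∃ D : Finset G.Subgraph, G.IsPathDecomposition D ∧ D.card = k}

/-- A Gallai graph: the path number is at most `⌊n / 2⌋`, where `n` is the number of
non-isolated vertices. -/
def IsGallai {V : Type*} (G : SimpleGraph V) : Prop :=
  G.pathNumber ≤ G.support.ncard / 2

/-- The single edges of a finite graph form a path decomposition. -/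
theorem exists_isPathDecomposition {V : Type*} [Finite V] (G : SimpleGraph V) :
    ∃ D : Finset G.Subgraph, G.IsPathDecomposition D := by
  classical
  have hfin : {H : G.Subgraph | ∃ (u v : V) (h : G.Adj u v), H = G.subgraphOfAdj h}.Finite := by
    refine (Set.finite_range (fun x : {x : V × V // G.Adj x.1 x.2} =>
      G.subgraphOfAdj x.2)).subset ?_
    rintro H ⟨u, v, h, rfl⟩
    exact ⟨⟨(u, v), h⟩, rfl⟩
  refine ⟨hfin.toFinset, ?_, ?_, ?_⟩
  · intro H hH
    obtain ⟨u, v, h, rfl⟩ := hfin.mem_toFinset.1 hH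
    refine ⟨u, v, h.toWalk, ?_, by simp⟩
    simp [h.ne]
  · intro H hH K hK hne
    obtain ⟨u, v, h, rfl⟩ := hfin.mem_toFinset.1 hH
    obtain ⟨u', v', h', rfl⟩ := hfin.mem_toFinset.1 hK
    rw [edgeSet_subgraphOfAdj, edgeSet_subgraphOfAdj, Set.disjoint_singleton]
    intro he
    apply hne
    rcases Sym2.eq_iff.1 he with ⟨rfl, rfl⟩ | ⟨rfl, rfl⟩
    · rfl
    · exact (subgraphOfAdj_symm h).symm
  · intro e he
    induction e with
    | _ u v =>
      have h : G.Adj u v := he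
      exact ⟨G.subgraphOfAdj h, hfin.mem_toFinset.2 ⟨u, v, h, rfl⟩, by simp⟩

end SimpleGraph

/-! Paths can be peeled off as long as each subgraph with an edge has two vertices `u`, `v` of
degree at most two in one component. Join them by a geodesic. Each has at most one edge off the
geodesic, and that edge leads to a vertex outside, since otherwise it would be a shortcut; girth at
least five keeps the two new ends distinct. The extended path contains all edges at `u` and `v`, so
its removal isolates both: one path is spent on two non-isolated vertices (`isGallai_of_forall_le`).

Such vertices come from counting. With `m` edges, `n` non-isolated vertices and mod 2 cycle space
`Z`, `dim Z ≥ m - n + 1`. In a plane graph of girth at least six, face boundaries span `Z`, each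
edge lies on at most two of them, and each nonzero one has at least six edges, so `6 dim Z ≤ 2m`.
Hence `2m ≤ 3n - 3`, whereas with at most one non-isolated vertex of degree at most two the degree
sum would be at least `3n - 2`.

Faces are not defined topologically. The label of a side of a segment is the function sending each
mod 2 cycle `C` to its winding number there, the parity of the `C`-segments above. Crossing a
segment `s` adds `C s`, so `C` is the jump of "evaluate at `C`"; around a vertex the labels close
up, so the boundary of each label is a cycle. These two facts suffice for the dimension bound,
without the Jordan curve theorem or Euler's formula. -/

namespace SimpleGraph

/-! ### Peeling off paths through two vertices of low degree -/

variable {V : Type*} {G : SimpleGraph V}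

/-- Adding a path to a path decomposition of the graph without the edges of that path. -/
theorem IsPathDecomposition.exists_of_deleteEdges {x y : V} {q : G.Walk x y} (hq : q.IsPath)
    {G' : SimpleGraph V} (hG' : G' = G.deleteEdges {e | e ∈ q.edges})
    {D : Finset G'.Subgraph} (hD : G'.IsPathDecomposition D) :
    ∃ D' : Finset G.Subgraph, G.IsPathDecomposition D' ∧ D'.card ≤ D.card + 1 := by
  classical
  have hle : G' ≤ G := hG' ▸ G.deleteEdges_le _
  let φ : G'.Subgraph → G.Subgraph := fun H => H.map (Hom.ofLE hle)
  have hφ : ∀ H, (φ H).edgeSet = H.edgeSet := by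
    intro H
    ext e
    induction e with
    | _ a b => simp [φ]
  have hdisj : ∀ H : G'.Subgraph, Disjoint (φ H).edgeSet q.toSubgraph.edgeSet := by
    intro H
    rw [hφ, Set.disjoint_left]
    intro e he heq
    have h1 := H.edgeSet_subset he
    rw [hG', edgeSet_deleteEdges] at h1
    exact h1.2 (by simpa using heq)
  refine ⟨insert q.toSubgraph (D.image φ), ⟨?_, ?_, ?_⟩, ?_⟩
  · intro H hH
    rcases Finset.mem_insert.1 hH with rfl | hH
    · exact ⟨x, y, q, hq, rfl⟩
    · obtain ⟨K, hK, rfl⟩ := Finset.mem_image.1 hH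
      obtain ⟨u, v, p, hp, rfl⟩ := hD.isPath K hK
      exact ⟨u, v, p.mapLe hle, (Walk.isPath_mapLe hle).2 hp, by
        simp [φ, Walk.mapLe, Walk.toSubgraph_map]⟩
  · intro H hH K hK hne
    rcases Finset.mem_insert.1 hH with rfl | hH <;> rcases Finset.mem_insert.1 hK with rfl | hK
    · exact absurd rfl hne
    · obtain ⟨K, hK, rfl⟩ := Finset.mem_image.1 hK
      exact (hdisj K).symm
    · obtain ⟨H, hH, rfl⟩ := Finset.mem_image.1 hH
      exact hdisj H
    · obtain ⟨K, hKD, rfl⟩ := Finset.mem_image.1 hK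
      obtain ⟨H, hHD, rfl⟩ := Finset.mem_image.1 hH
      rw [hφ, hφ]
      exact hD.edgeDisjoint H hHD K hKD fun h => hne (by rw [h])
  · intro e he
    by_cases heq : e ∈ q.edges
    · exact ⟨q.toSubgraph, by simp, by simpa using heq⟩
    · obtain ⟨H, hH, heH⟩ := hD.cover e (by
        rw [hG', edgeSet_deleteEdges]
        exact ⟨he, heq⟩)
      exact ⟨φ H, Finset.mem_insert_of_mem (Finset.mem_image_of_mem _ hH), by rwa [hφ]⟩
  · exact (Finset.card_insert_le _ _).trans (Nat.succ_le_succ Finset.card_image_le)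

/-- The neighbours of the initial vertex `u` of a geodesic, when `u` has degree at most two: at most
one edge at `u` is not on the geodesic, and it leads to a vertex outside. -/
theorem Walk.adj_start_of_length_eq_dist {u v : V} (huv : u ≠ v) (p : G.Walk u v)
    (hp : p.length = G.dist u v) (hfin : (G.neighborSet u).Finite)
    (hu : (G.neighborSet u).ncard ≤ 2) :
    (∀ w, G.Adj u w → s(u, w) ∈ p.edges) ∨
      ∃ a, G.Adj u a ∧ a ∉ p.support ∧ ∀ w, G.Adj u w → w = a ∨ s(u, w) ∈ p.edges := by
  classical
  by_cases h : ∃ a, G.Adj u a ∧ s(u, a) ∉ p.edges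
  swap
  · push Not at h
    exact Or.inl h
  obtain ⟨a, hua, ha⟩ := h
  refine Or.inr ⟨a, hua, fun hmem => ?_, fun w huw => ?_⟩
  -- Entering the geodesic at `a` along the edge `ua` cannot shorten it, so `a` is at most one step
  -- from `u` on it, and `ua` would be an edge of it.
  · have hlen : (p.takeUntil a hmem).length + (p.dropUntil a hmem).length = p.length := by
      rw [← Walk.length_append, p.take_spec hmem]
    have h1 : G.dist u v ≤ (Walk.cons hua (p.dropUntil a hmem)).length := G.dist_le _
    rw [Walk.length_cons] at h1
    have h2 : (p.takeUntil a hmem).length ≤ 1 := by omega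
    apply ha
    apply p.edges_takeUntil_subset_edges hmem
    revert h2
    generalize p.takeUntil a hmem = t
    intro h2
    match t, h2 with
    | .nil, _ => exact absurd rfl hua.ne
    | .cons h .nil, _ => simp
    | .cons h (.cons h' t'), h2 => simp at h2
  · by_contra hcon
    push Not at hcon
    have hnil : ¬ p.Nil := fun hn => huv hn.eq
    have hsnd : s(u, p.snd) ∈ p.edges := by
      cases p with
      | nil => exact absurd rfl huv
      | cons h t => simp
    have hadj : G.Adj u p.snd := p.adj_snd hnil
    have hsub : ({p.snd, a, w} : Set V) ⊆ G.neighborSet u := by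
      rintro z (rfl | rfl | rfl)
      · exact hadj
      · exact hua
      · exact huw
    have h3 : ({p.snd, a, w} : Set V).ncard = 3 := by
      rw [Set.ncard_eq_three]
      refine ⟨p.snd, a, w, ?_, ?_, ?_, rfl⟩
      · rintro rfl; exact ha hsnd
      · intro h; exact hcon.2 (h ▸ hsnd)
      · exact fun h => hcon.1 h.symm
    have := Set.ncard_le_ncard hsub hfin
    omega

/-- In a graph of girth at least five, two connected vertices of degree at most two have all their
edges on a common path. -/
theorem exists_isPath_forall_adj_mem_edges [Finite V] (hg : 5 ≤ G.egirth) {u v : V} (huv : u ≠ v)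
    (hr : G.Reachable u v) (hu : (G.neighborSet u).ncard ≤ 2) (hv : (G.neighborSet v).ncard ≤ 2) :
    ∃ (x y : V) (q : G.Walk x y), q.IsPath ∧ (∀ w, G.Adj u w → s(u, w) ∈ q.edges) ∧
      ∀ w, G.Adj v w → s(v, w) ∈ q.edges := by
  obtain ⟨p, hp⟩ := hr.exists_walk_length_eq_dist
  have hpath : p.IsPath := p.isPath_of_length_eq_dist hp
  have hA := p.adj_start_of_length_eq_dist huv hp (Set.toFinite _) hu
  have hB := p.reverse.adj_start_of_length_eq_dist huv.symm
    (by rw [Walk.length_reverse, hp, dist_comm]) (Set.toFinite _) hv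
  simp only [Walk.edges_reverse, List.mem_reverse, Walk.support_reverse] at hB
  rcases hA with hA | ⟨a, hua, ha, hA⟩ <;> rcases hB with hB | ⟨b, hvb, hb, hB⟩
  · exact ⟨u, v, p, hpath, hA, hB⟩
  · refine ⟨u, b, p.concat hvb, hpath.concat hb hvb, fun w hw => ?_, fun w hw => ?_⟩
    · simp [Walk.edges_concat, hA w hw]
    · rcases hB w hw with rfl | h
      · simp [Walk.edges_concat]
      · simp [Walk.edges_concat, h]
  · refine ⟨a, v, .cons hua.symm p, hpath.cons ha, fun w hw => ?_, fun w hw => ?_⟩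
    · rcases hA w hw with rfl | h
      · simp [Sym2.eq_swap]
      · simp [h]
    · simp [hB w hw]
  -- If `a = b`, the path `u a v` and the geodesic are distinct and have length at most two, which
  -- yields a cycle of length at most four.
  · have hab : a ≠ b := by
      rintro rfl
      let r : G.Walk u v := .cons hua (.cons hvb.symm .nil)
      have hrp : r.IsPath := by
        simp [r, huv, hua.ne, hvb.ne.symm]
      have hne : p ≠ r := by
        rintro rfl
        exact ha (by simp [r])
      have h2 : p.length ≤ 2 := hp ▸ G.dist_le r
      obtain ⟨w, _, _, c, hc, hlen⟩ := hpath.exists_isCycle_length_le_add_of_ne hrp hne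
      have hlen' : c.length ≤ 4 := by
        refine hlen.trans ?_
        have : r.length = 2 := rfl
        omega
      have := hg.trans (egirth_le_length hc)
      have h5 : 5 ≤ c.length := by exact_mod_cast this
      omega
    refine ⟨a, b, .cons hua.symm (p.concat hvb), ?_, fun w hw => ?_, fun w hw => ?_⟩
    · refine (hpath.concat hb hvb).cons ?_
      simp [Walk.support_concat, ha, hab]
    · rcases hA w hw with rfl | h
      · simp [Sym2.eq_swap]
      · simp [Walk.edges_concat, h]
    · rcases hB w hw with rfl | h
      · simp [Walk.edges_concat]
      · simp [Walk.edges_concat, h]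

/-- A graph of girth at least five is a Gallai graph if each of its subgraphs with an edge has two
connected vertices of degree at most two. -/
theorem isGallai_of_forall_le [Finite V] (hg : 5 ≤ G.egirth)
    (hlow : ∀ H ≤ G, H ≠ ⊥ → ∃ u v, u ≠ v ∧ H.Reachable u v ∧ (H.neighborSet u).ncard ≤ 2 ∧
      (H.neighborSet v).ncard ≤ 2) : G.IsGallai := by
  classical
  have key : ∀ (n : ℕ) (H : SimpleGraph V), H ≤ G → H.edgeSet.ncard ≤ n →
      ∃ D : Finset H.Subgraph, H.IsPathDecomposition D ∧ D.card ≤ H.support.ncard / 2 := by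
    intro n
    induction n with
    | zero =>
      intro H _ hn
      have : H.edgeSet = ∅ := (Set.ncard_eq_zero (Set.toFinite _)).1 (Nat.le_zero.1 hn)
      exact ⟨∅, ⟨by simp, by simp, by simp [this]⟩, by simp⟩
    | succ n ih =>
      intro H hH hn
      by_cases hbot : H = ⊥
      · subst hbot
        exact ⟨∅, ⟨by simp, by simp, by simp⟩, by simp⟩
      obtain ⟨u, v, huv, hr, hu, hv⟩ := hlow H hH hbot
      obtain ⟨x, y, q, hq, hqu, hqv⟩ :=
        exists_isPath_forall_adj_mem_edges (hg.trans (egirth_anti hH)) huv hr hu hv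
      set H' := H.deleteEdges {e | e ∈ q.edges} with hH'
      have hsupp : ∀ w w', w ≠ w' → H.Reachable w w' → w ∈ H.support := by
        rintro w w' hne ⟨p⟩
        cases p with
        | nil => exact absurd rfl hne
        | cons h _ => exact ⟨_, h⟩
      have hus := hsupp u v huv hr
      have hvs := hsupp v u huv.symm hr.symm
      obtain ⟨w, huw⟩ := hus
      have hlt : H'.edgeSet.ncard < H.edgeSet.ncard := by
        refine Set.ncard_lt_ncard ?_ (Set.toFinite _)
        rw [hH', edgeSet_deleteEdges]
        refine ⟨Set.sdiff_subset, fun h => ?_⟩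
        exact (h (show s(u, w) ∈ H.edgeSet from huw)).2 (hqu w huw)
      obtain ⟨D, hD, hcard⟩ := ih H' ((H.deleteEdges_le _).trans hH) (by omega)
      obtain ⟨D', hD', hcard'⟩ := IsPathDecomposition.exists_of_deleteEdges hq hH' hD
      refine ⟨D', hD', hcard'.trans ?_⟩
      -- The loss of two non-isolated vertices pays for the one additional path.
      have hsub : H'.support ⊆ H.support \ {u, v} := by
        intro z hz
        obtain ⟨z', hz'⟩ := hz
        replace hz' : H'.Adj z z' := hz'
        rw [hH', deleteEdges_adj] at hz'
        refine ⟨⟨z', hz'.1⟩, ?_⟩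
        rintro (rfl | rfl)
        · exact hz'.2 (hqu _ hz'.1)
        · exact hz'.2 (hqv _ hz'.1)
      have h1 := Set.ncard_le_ncard hsub (Set.toFinite _)
      have h2 : ({u, v} : Set V) ⊆ H.support := by
        rintro z (rfl | rfl)
        · exact ⟨w, huw⟩
        · exact hvs
      have h3 := Set.ncard_sdiff_add_ncard_of_subset h2 (Set.toFinite _)
      rw [Set.ncard_pair huv] at h3
      omega
  obtain ⟨D, hD, hcard⟩ := key _ G le_rfl le_rfl
  exact (Nat.sInf_le ⟨D, hD, rfl⟩ : G.pathNumber ≤ D.card).trans hcard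

end SimpleGraph

/-! ### Dimension against minimum weight -/

/-- If a space of mod 2 vectors is spanned by a family of vectors such that each coordinate is nonzero
in at most two of them, then its dimension is bounded in terms of the minimum weight. -/
theorem mul_finrank_le_of_double_cover {E Λ : Type*} [Fintype E] [Fintype Λ] [DecidableEq Λ]
    (Z : Submodule (ZMod 2) (E → ZMod 2)) (a b : E → Λ)
    (hZ : ∀ f, (fun e => (if a e = f then 1 else 0) + (if b e = f then 1 else 0)) ∈ Z)
    (hw : ∀ C ∈ Z, ∃ w : Λ → ZMod 2, ∀ e, C e = w (a e) + w (b e)) (g : ℕ)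
    (hg : ∀ z ∈ Z, z ≠ 0 → g ≤ (Finset.univ.filter fun e => z e ≠ 0).card) :
    g * Module.finrank (ZMod 2) Z ≤ 2 * Fintype.card E := by
  classical
  let d : Λ → E → ZMod 2 := fun f e => (if a e = f then 1 else 0) + (if b e = f then 1 else 0)
  -- Zero vectors are discarded: the weight bound needs nonzero ones, and the span does not change.
  let F : Finset Λ := Finset.univ.filter fun f => d f ≠ 0
  have hspan : Z ≤ Submodule.span (ZMod 2) (F.image d : Set (E → ZMod 2)) := by
    intro C hC
    obtain ⟨w, hw⟩ := hw C hC
    have hCeq : C = ∑ f, w f • d f := by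
      ext e
      simp only [Finset.sum_apply, Pi.smul_apply, d, smul_eq_mul, mul_add, mul_ite, mul_one,
        mul_zero, Finset.sum_add_distrib, Finset.sum_ite_eq, Finset.mem_univ, if_true]
      exact hw e
    rw [hCeq]
    refine Submodule.sum_mem _ fun f _ => ?_
    by_cases hf : d f = 0
    · rw [hf, smul_zero]
      exact Submodule.zero_mem _
    · refine Submodule.smul_mem _ _ (Submodule.subset_span ?_)
      simp only [Finset.coe_image]
      exact ⟨f, by simp [F, hf], rfl⟩
  have h1 : Module.finrank (ZMod 2) Z ≤ F.card :=
    (Submodule.finrank_mono hspan).trans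
      ((finrank_span_finset_le_card (R := ZMod 2) (F.image d)).trans Finset.card_image_le)
  have h2 : F.card * g ≤ ∑ f ∈ F, (Finset.univ.filter fun e => d f e ≠ 0).card := by
    rw [← smul_eq_mul]
    exact Finset.card_nsmul_le_sum _ _ _ fun f hf => hg _ (hZ f) (Finset.mem_filter.1 hf).2
  have h3 : ∑ f ∈ F, (Finset.univ.filter fun e => d f e ≠ 0).card =
      ∑ e, (F.filter fun f => d f e ≠ 0).card := by
    simp only [Finset.card_filter]
    exact Finset.sum_comm
  have h4 : ∑ e, (F.filter fun f => d f e ≠ 0).card ≤ ∑ _e : E, 2 := by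
    refine Finset.sum_le_sum fun e _ => ?_
    refine (Finset.card_le_card (t := {a e, b e}) fun f hf => ?_).trans Finset.card_le_two
    by_contra hcon
    simp only [Finset.mem_insert, Finset.mem_singleton, not_or] at hcon
    exact (Finset.mem_filter.1 hf).2 (by simp [d, Ne.symm hcon.1, Ne.symm hcon.2])
  simp only [Finset.sum_const, Finset.card_univ, smul_eq_mul] at h4
  calc g * Module.finrank (ZMod 2) Z ≤ F.card * g := by
        rw [mul_comm]; exact Nat.mul_le_mul_right _ h1
    _ ≤ 2 * Fintype.card E := by rw [mul_comm 2]; omega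

/-! ### The mod 2 cycle space of a graph -/

namespace SimpleGraph

variable {V : Type*} (G : SimpleGraph V)

open scoped Classical in
/-- The sums mod 2 of a function on the edges around each vertex. -/
noncomputable def incidenceSum [Fintype V] : (G.edgeSet → ZMod 2) →ₗ[ZMod 2] (V → ZMod 2) where
  toFun z v := ∑ e : G.edgeSet, if v ∈ e.1 then z e else 0
  map_add' x y := by
    ext v
    simp only [Pi.add_apply, ← Finset.sum_add_distrib]
    exact Finset.sum_congr rfl fun e _ => by split_ifs <;> simp
  map_smul' c x := by
    ext v
    simp only [Pi.smul_apply, RingHom.id_apply, Finset.smul_sum]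
    exact Finset.sum_congr rfl fun e _ => by split_ifs <;> simp

open scoped Classical in
theorem incidenceSum_apply [Fintype V] (z : G.edgeSet → ZMod 2) (v : V) :
    G.incidenceSum z v = ∑ e : G.edgeSet, if v ∈ e.1 then z e else 0 := rfl

/-- The cycle space of a graph over the field with two elements. -/
noncomputable def cycleSpace [Fintype V] : Submodule (ZMod 2) (G.edgeSet → ZMod 2) :=
  LinearMap.ker G.incidenceSum

theorem mem_cycleSpace [Fintype V] {z : G.edgeSet → ZMod 2} :
    z ∈ G.cycleSpace ↔ ∀ v, G.incidenceSum z v = 0 := by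
  rw [cycleSpace, LinearMap.mem_ker, funext_iff]
  rfl

theorem sum_incidenceSum [Fintype V] (z : G.edgeSet → ZMod 2) : ∑ v, G.incidenceSum z v = 0 := by
  classical
  simp only [incidenceSum_apply]
  rw [Finset.sum_comm]
  refine Finset.sum_eq_zero fun e _ => ?_
  rw [← Finset.sum_filter, Finset.sum_const]
  have : (Finset.univ.filter fun v => v ∈ e.1).card = 2 := by
    obtain ⟨e, he⟩ := e
    induction e with
    | _ x y =>
      have hxy : x ≠ y := G.ne_of_adj he
      rw [← Finset.card_pair hxy]
      congr 1
      ext v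
      simp
  rw [this, two_nsmul, CharTwo.add_self_eq_zero]

theorem incidenceSum_eq_zero_of_notMem_support [Fintype V] (z : G.edgeSet → ZMod 2) {v : V}
    (hv : v ∉ G.support) : G.incidenceSum z v = 0 := by
  classical
  rw [incidenceSum_apply]
  refine Finset.sum_eq_zero fun e _ => if_neg fun hve => hv ?_
  obtain ⟨e, he⟩ := e
  obtain ⟨w, rfl⟩ := Sym2.mem_iff_exists.1 hve
  exact ⟨w, he⟩

/-- The dimension of the cycle space of a graph with at least one edge. -/
theorem card_edgeSet_lt_finrank_cycleSpace_add [Fintype V] (hG : G ≠ ⊥) :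
    G.edgeSet.ncard + 1 ≤ Module.finrank (ZMod 2) G.cycleSpace + G.support.ncard := by
  classical
  obtain ⟨v₀, w₀, h₀⟩ := G.ne_bot_iff_exists_adj.1 hG
  -- The incidence sums add up to zero, so the equation at `v₀` follows from the others, and the
  -- remaining non-isolated vertices give all the equations needed.
  let S := {v : V // v ∈ G.support ∧ v ≠ v₀}
  let T : (G.edgeSet → ZMod 2) →ₗ[ZMod 2] (S → ZMod 2) :=
    (LinearMap.funLeft (ZMod 2) (ZMod 2) (fun v : S => v.1)).comp G.incidenceSum
  have hker : LinearMap.ker T ≤ G.cycleSpace := by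
    intro z hz
    have hz' : ∀ v, v ≠ v₀ → G.incidenceSum z v = 0 := by
      intro v hv
      by_cases hvs : v ∈ G.support
      · exact congrFun (LinearMap.mem_ker.1 hz) ⟨v, hvs, hv⟩
      · exact G.incidenceSum_eq_zero_of_notMem_support z hvs
    rw [mem_cycleSpace]
    intro v
    by_cases hv : v = v₀
    · subst hv
      rw [← G.sum_incidenceSum z]
      exact (Finset.sum_eq_single v (fun w _ hw => hz' w hw) (by simp)).symm
    · exact hz' v hv
  have h1 := LinearMap.finrank_range_add_finrank_ker T
  have h2 : Module.finrank (ZMod 2) (LinearMap.range T) ≤ Fintype.card S := by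
    simpa using Submodule.finrank_le (LinearMap.range T)
  have h3 := Submodule.finrank_mono hker
  rw [Module.finrank_fintype_fun_eq_card] at h1
  have h4 : G.edgeSet.ncard = Fintype.card G.edgeSet := by
    rw [← Nat.card_eq_fintype_card, Nat.card_coe_set_eq]
  have h5 : Fintype.card S + 1 = G.support.ncard := by
    have : Fintype.card S = (G.support \ {v₀}).ncard := by
      rw [← Nat.card_eq_fintype_card, ← Nat.card_coe_set_eq]
      rfl
    rw [this]
    exact Set.ncard_sdiff_singleton_add_one ⟨w₀, h₀⟩ (Set.toFinite _)
  omega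

/-- A nonzero element of the cycle space contains a cycle. -/
theorem le_card_of_mem_cycleSpace [Fintype V] {g : ℕ} (hg : g ≤ G.egirth) {z : G.edgeSet → ZMod 2}
    (hz : z ∈ G.cycleSpace) (hne : z ≠ 0) : g ≤ {e | z e ≠ 0}.ncard := by
  classical
  let H : SimpleGraph V := fromEdgeSet ((↑) '' {e | z e ≠ 0})
  have hHG : H ≤ G := by
    intro x y hxy
    obtain ⟨⟨⟨e, he⟩, -, hxy'⟩, -⟩ := (fromEdgeSet_adj _).1 hxy
    have : e = s(x, y) := hxy'
    rw [← mem_edgeSet, ← this]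
    exact he
  have hHz : ∀ x y (h : G.Adj x y), H.Adj x y ↔ z ⟨s(x, y), h⟩ ≠ 0 := by
    intro x y h
    rw [fromEdgeSet_adj]
    constructor
    · rintro ⟨⟨e, he, hxy⟩, -⟩
      have : e = ⟨s(x, y), h⟩ := Subtype.ext hxy
      rwa [← this]
    · exact fun h' => ⟨⟨_, h', rfl⟩, h.ne⟩
  -- By parity, no vertex has exactly one edge in the support of `z`.
  have hdeg : ∀ v x, H.Adj v x → ∃ y, y ≠ x ∧ H.Adj v y := by
    intro v x hvx
    by_contra hcon
    push Not at hcon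
    have h0 := (G.mem_cycleSpace.1 hz) v
    rw [incidenceSum_apply, Finset.sum_eq_single ⟨s(v, x), hHG hvx⟩] at h0
    · rw [if_pos (by simp)] at h0
      exact (hHz v x (hHG hvx)).1 hvx h0
    · rintro ⟨e, he⟩ - hne'
      split_ifs with hve
      · obtain ⟨y, rfl⟩ := Sym2.mem_iff_exists.1 hve
        by_contra hzy
        refine hcon y ?_ ((hHz v y he).2 hzy)
        rintro rfl
        exact hne' rfl
      · rfl
    · simp
  have hcyc : ¬ H.IsAcyclic := by
    intro hac
    have hex : ∃ e, z e ≠ 0 := by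
      by_contra h
      push Not at h
      exact hne (funext h)
    obtain ⟨⟨e, he⟩, hze⟩ := hex
    induction e with
    | _ a b =>
      have : Nonempty V := ⟨a⟩
      -- The start of a longest path has a second neighbour; in an acyclic graph it is off the path,
      -- which can then be prolonged.
      obtain ⟨u, v, p, hp, hmax⟩ := Walk.exists_isPath_forall_isPath_length_le_length H
      have hab : H.Adj a b := (hHz a b he).2 hze
      have hpos : 1 ≤ p.length := by
        have := hmax a b hab.toWalk hab.isPath_toWalk
        simpa using this
      have hnil : ¬ p.Nil := by
        rw [← Walk.length_eq_zero_iff]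
        omega
      obtain ⟨y, hy, huy⟩ := hdeg u p.snd (p.adj_snd hnil)
      by_cases hys : y ∈ p.support
      · exact hy (hac.eq_snd_of_adj_start hp huy hys)
      · have := hmax _ _ (Walk.cons huy.symm p) (hp.cons hys)
        rw [Walk.length_cons] at this
        omega
  unfold IsAcyclic at hcyc
  push Not at hcyc
  obtain ⟨v, c, hc⟩ := hcyc
  have h1 : (g : ℕ∞) ≤ c.length := (hg.trans (egirth_anti hHG)).trans (egirth_le_length hc)
  have h2 : c.length ≤ H.edgeSet.ncard := by
    rw [← Walk.length_edges, ← List.toFinset_card_of_nodup hc.edges_nodup, ← Set.ncard_coe_finset]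
    refine Set.ncard_le_ncard (fun e he => ?_) (Set.toFinite _)
    exact c.edges_subset_edgeSet (by simpa using he)
  have h3 : H.edgeSet.ncard ≤ {e | z e ≠ 0}.ncard := by
    rw [← Set.ncard_image_of_injective {e | z e ≠ 0} Subtype.val_injective]
    refine Set.ncard_le_ncard ?_ (Set.toFinite _)
    rw [edgeSet_fromEdgeSet]
    exact Set.sdiff_subset
  have h4 : g ≤ c.length := by exact_mod_cast h1
  omega

end SimpleGraph

/-! ### Winding numbers mod 2 in a system of segments -/

/-- A finite system of non-vertical segments in the plane, given by the abscissas of their ends,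
their slopes and their intercepts. Two segments meet at most in a common end, and distinct ends
have distinct abscissas. -/
structure SegmentSystem (S : Type*) where
  left : S → ℝ
  right : S → ℝ
  slope : S → ℝ
  intercept : S → ℝ
  left_lt_right : ∀ s, left s < right s
  eq_end_of_eq : ∀ s s', s ≠ s' → ∀ t, left s ≤ t → t ≤ right s → left s' ≤ t → t ≤ right s' →
    slope s * t + intercept s = slope s' * t + intercept s' → t = left s ∨ t = right s
  eq_of_end : ∀ s s' t, (left s = t ∨ right s = t) → (left s' = t ∨ right s' = t) →
    slope s * t + intercept s = slope s' * t + intercept s'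

/-- A telescoping sum: adding vectors one after the other, in the order of decreasing keys. -/
theorem sum_ite_partialSum_eq {S Λ : Type*} [AddCommGroup Λ] [DecidableEq Λ] (κ : S → ℝ) (D : Finset S)
    (hκ : Set.InjOn κ D) (v : S → Λ) (x f : Λ) :
    ∑ s ∈ D, ((if x + ∑ s' ∈ D with κ s < κ s', v s' = f then (1 : ZMod 2) else 0) +
      (if x + ∑ s' ∈ D with κ s < κ s', v s' + v s = f then 1 else 0)) =
      (if x = f then 1 else 0) + (if x + ∑ s ∈ D, v s = f then 1 else 0) := by
  classical
  induction D using Finset.induction_on_min_value κ with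
  | empty => simp [CharTwo.add_self_eq_zero]
  | insert a D ha hmin ih =>
    have hlt : ∀ s ∈ D, κ a < κ s := fun s hs =>
      lt_of_le_of_ne (hmin s hs) fun h => by
        have := hκ (by simp) (by simp [hs]) h
        exact ha (this ▸ hs)
    -- The key of `a` is minimal, so `a` is added last, after all of `D`.
    have h1 : (insert a D).filter (fun s' => κ a < κ s') = D := by
      ext s
      simp only [Finset.mem_filter, Finset.mem_insert]
      refine ⟨fun h => h.1.resolve_left ?_, fun h => ⟨Or.inr h, hlt s h⟩⟩
      rintro rfl
      exact lt_irrefl _ h.2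
    have h2 : ∀ s ∈ D, (insert a D).filter (fun s' => κ s < κ s') =
        D.filter (fun s' => κ s < κ s') := by
      intro s hs
      rw [Finset.filter_insert, if_neg (hlt s hs).not_gt]
    rw [Finset.sum_insert ha, Finset.sum_insert ha, h1]
    refine (congrArg _ ((Finset.sum_congr rfl fun s hs => by rw [h2 s hs]).trans
      (ih (hκ.mono (by simp))))).trans ?_
    rw [add_assoc x, add_comm (v a) (∑ s ∈ D, v s)]
    generalize (if x = f then (1 : ZMod 2) else 0) = p
    generalize (if x + ∑ s ∈ D, v s = f then (1 : ZMod 2) else 0) = q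
    generalize (if x + (∑ s ∈ D, v s + v a) = f then (1 : ZMod 2) else 0) = r
    have := CharTwo.add_self_eq_zero q
    linear_combination this

namespace SegmentSystem

open Filter Topology

variable {S : Type*} (Γ : SegmentSystem S)

/-- The ordinate of the point of a segment with a given abscissa. -/
def height (s : S) (t : ℝ) : ℝ := Γ.slope s * t + Γ.intercept s

theorem continuous_height (s : S) : Continuous (Γ.height s) := by
  unfold height
  fun_prop

theorem height_ne {s s' : S} (hne : s ≠ s') {t : ℝ} (h1 : Γ.left s < t) (h2 : t < Γ.right s)
    (h3 : Γ.left s' ≤ t) (h4 : t ≤ Γ.right s') : Γ.height s t ≠ Γ.height s' t := fun h => by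
  rcases Γ.eq_end_of_eq s s' hne t h1.le h2.le h3 h4 h with rfl | rfl
  · exact lt_irrefl _ h1
  · exact lt_irrefl _ h2

theorem eventually_height_lt_iff {s s' : S} {t : ℝ} (h : Γ.height s t ≠ Γ.height s' t) :
    ∀ᶠ t' in 𝓝 t, (Γ.height s t' < Γ.height s' t' ↔ Γ.height s t < Γ.height s' t) := by
  rcases h.lt_or_gt with h | h
  · filter_upwards [(Γ.continuous_height s).continuousAt.eventually_lt
      (Γ.continuous_height s').continuousAt h] with t' ht'
    exact iff_of_true ht' h
  · filter_upwards [(Γ.continuous_height s').continuousAt.eventually_lt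
      (Γ.continuous_height s).continuousAt h] with t' ht'
    exact iff_of_false ht'.not_gt h.not_gt

theorem height_sub_height {s s' : S} {t : ℝ} (h : Γ.height s t = Γ.height s' t) (t' : ℝ) :
    Γ.height s' t' - Γ.height s t' = (Γ.slope s' - Γ.slope s) * (t' - t) := by
  unfold height at *
  linear_combination -h

theorem slope_ne_of_left_eq {s s' : S} (hne : s ≠ s') (h : Γ.left s = Γ.left s') :
    Γ.slope s ≠ Γ.slope s' := by
  intro hs
  have h0 : Γ.height s (Γ.left s) = Γ.height s' (Γ.left s) :=
    Γ.eq_of_end s s' _ (Or.inl rfl) (Or.inl h.symm)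
  obtain ⟨t, ht1, ht2⟩ := exists_between (lt_min (Γ.left_lt_right s) (h ▸ Γ.left_lt_right s'))
  rw [lt_min_iff] at ht2
  refine Γ.height_ne hne ht1 ht2.1 (h ▸ ht1.le) ht2.2.le ?_
  have := Γ.height_sub_height h0 t
  rw [hs, sub_self, zero_mul] at this
  linarith

theorem slope_ne_of_right_eq {s s' : S} (hne : s ≠ s') (h : Γ.right s = Γ.right s') :
    Γ.slope s ≠ Γ.slope s' := by
  intro hs
  have h0 : Γ.height s (Γ.right s) = Γ.height s' (Γ.right s) :=
    Γ.eq_of_end s s' _ (Or.inr rfl) (Or.inr h.symm)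
  obtain ⟨t, ht1, ht2⟩ := exists_between (max_lt (Γ.left_lt_right s) (h ▸ Γ.left_lt_right s'))
  rw [max_lt_iff] at ht1
  refine Γ.height_ne hne ht1.1 ht2 ht1.2.le (h ▸ ht2.le) ?_
  have := Γ.height_sub_height h0 t
  rw [hs, sub_self, zero_mul] at this
  linarith

variable [Fintype S]

open scoped Classical

/-- A function mod 2 on the segments is even if it sums to zero around each end. -/
def IsEven (C : S → ZMod 2) : Prop :=
  ∀ t, ∑ s, ((if Γ.left s = t then C s else 0) + (if Γ.right s = t then C s else 0)) = 0

/-- The number mod 2 of the segments, weighted with `C`, above the point of `s` at abscissa `t`. -/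
noncomputable def numAbove (C : S → ZMod 2) (s : S) (t : ℝ) : ZMod 2 :=
  -- The half-open range makes the count continuous from the right along `s`; continuity from the
  -- left takes evenness.
  ∑ s', if Γ.left s' ≤ t ∧ t < Γ.right s' ∧ Γ.height s t < Γ.height s' t then C s' else 0

/-- The number mod 2 of the segments, weighted with `C`, that pass over the point `(t, y)`. -/
noncomputable def numOver (C : S → ZMod 2) (t y : ℝ) : ZMod 2 :=
  ∑ s', if Γ.left s' < t ∧ t < Γ.right s' ∧ y < Γ.height s' t then C s' else 0

variable {Γ}

/-- All ends with abscissa `t` are the same point, so a property `Q` of that point selects either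
all of them or none. -/
theorem IsEven.sum_filter_eq_zero {C : S → ZMod 2} (hC : Γ.IsEven C) {t : ℝ} (Q : S → Prop)
    (hQ : ∀ s s', (Γ.left s = t ∨ Γ.right s = t) → (Γ.left s' = t ∨ Γ.right s' = t) → Q s → Q s') :
    ∑ s, ((if Γ.left s = t ∧ Q s then C s else 0) + (if Γ.right s = t ∧ Q s then C s else 0)) =
      0 := by
  by_cases h : ∃ s, (Γ.left s = t ∨ Γ.right s = t) ∧ Q s
  · obtain ⟨s₀, hs₀, hQs⟩ := h
    refine Eq.trans (Finset.sum_congr rfl fun s _ => ?_) (hC t)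
    congr 1
    · exact if_congr ⟨fun h => h.1, fun h => ⟨h, hQ s₀ s hs₀ (Or.inl h) hQs⟩⟩ rfl rfl
    · exact if_congr ⟨fun h => h.1, fun h => ⟨h, hQ s₀ s hs₀ (Or.inr h) hQs⟩⟩ rfl rfl
  · push Not at h
    refine Finset.sum_eq_zero fun s _ => ?_
    rw [if_neg fun h' => h s (Or.inl h'.1) h'.2, if_neg fun h' => h s (Or.inr h'.1) h'.2, add_zero]

theorem eventually_numAbove_right (C : S → ZMod 2) {s : S} {t : ℝ} (h1 : Γ.left s < t)
    (h2 : t < Γ.right s) : ∀ᶠ t' in 𝓝[≥] t, Γ.numAbove C s t' = Γ.numAbove C s t := by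
  have key : ∀ s', ∀ᶠ t' in 𝓝[≥] t,
      ((Γ.left s' ≤ t' ∧ t' < Γ.right s' ∧ Γ.height s t' < Γ.height s' t') ↔
        (Γ.left s' ≤ t ∧ t < Γ.right s' ∧ Γ.height s t < Γ.height s' t)) := by
    intro s'
    by_cases hs : s = s'
    · subst hs
      simp
    rcases lt_or_ge t (Γ.left s') with hl | hl
    · filter_upwards [mem_nhdsWithin_of_mem_nhds (Iio_mem_nhds hl)] with t' ht'
      exact iff_of_false (fun h => (not_le.2 ht') h.1) fun h => (not_le.2 hl) h.1
    rcases le_or_gt (Γ.right s') t with hr | hr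
    · filter_upwards [self_mem_nhdsWithin] with t' ht'
      exact iff_of_false (fun h => (not_lt.2 (hr.trans ht')) h.2.1) fun h => (not_lt.2 hr) h.2.1
    filter_upwards [mem_nhdsWithin_of_mem_nhds (Iio_mem_nhds hr), self_mem_nhdsWithin,
      mem_nhdsWithin_of_mem_nhds (Γ.eventually_height_lt_iff (Γ.height_ne hs h1 h2 hl hr.le))]
      with t' ht1 ht2 ht3
    have h5 : Γ.left s' ≤ t' := hl.trans ht2
    have h6 : t' < Γ.right s' := ht1
    have h7 : _ ↔ _ := ht3
    tauto
  filter_upwards [eventually_all.2 key] with t' ht'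
  exact Finset.sum_congr rfl fun s' _ => if_congr (ht' s') rfl rfl

/-- Just before `t` the count has the segments ending at `t` in place of those starting there. Their
common end is on one side of `s`, so by evenness the exchange changes nothing mod 2. -/
theorem IsEven.eventually_numAbove_left {C : S → ZMod 2} (hC : Γ.IsEven C) {s : S} {t : ℝ}
    (h1 : Γ.left s < t) (h2 : t < Γ.right s) :
    ∀ᶠ t' in 𝓝[<] t, Γ.numAbove C s t' = Γ.numAbove C s t := by
  have key : ∀ s', ∀ᶠ t' in 𝓝[<] t,
      ((Γ.left s' ≤ t' ∧ t' < Γ.right s' ∧ Γ.height s t' < Γ.height s' t') ↔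
        (Γ.left s' < t ∧ t ≤ Γ.right s' ∧ Γ.height s t < Γ.height s' t)) := by
    intro s'
    by_cases hs : s = s'
    · subst hs
      simp
    rcases le_or_gt t (Γ.left s') with hl | hl
    · filter_upwards [self_mem_nhdsWithin] with t' ht'
      exact iff_of_false (fun h => (not_le.2 (ht'.trans_le hl)) h.1) fun h => (not_lt.2 hl) h.1
    rcases lt_or_ge (Γ.right s') t with hr | hr
    · filter_upwards [mem_nhdsWithin_of_mem_nhds (Ioi_mem_nhds hr)] with t' ht'
      exact iff_of_false (fun h => (lt_asymm ht') h.2.1) fun h => (not_le.2 hr) h.2.1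
    filter_upwards [mem_nhdsWithin_of_mem_nhds (Ioi_mem_nhds hl), self_mem_nhdsWithin,
      mem_nhdsWithin_of_mem_nhds (Γ.eventually_height_lt_iff (Γ.height_ne hs h1 h2 hl.le hr))]
      with t' ht1 ht2 ht3
    have h5 : Γ.left s' ≤ t' := le_of_lt ht1
    have h6 : t' < Γ.right s' := lt_of_lt_of_le ht2 hr
    have h7 : _ ↔ _ := ht3
    tauto
  filter_upwards [eventually_all.2 key] with t' ht'
  have hsum := hC.sum_filter_eq_zero (t := t) (fun s' => Γ.height s t < Γ.height s' t)
    (fun a b ha hb hQ => by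
      have : Γ.height a t = Γ.height b t := Γ.eq_of_end a b t ha hb
      rwa [← this])
  refine (Finset.sum_congr rfl fun s' _ => if_congr (ht' s') rfl rfl).trans ?_
  refine (add_zero _).symm.trans ((congrArg _ hsum.symm).trans ?_)
  rw [← Finset.sum_add_distrib, numAbove]
  refine Finset.sum_congr rfl fun s' _ => ?_
  have hlr := Γ.left_lt_right s'
  by_cases hQ : Γ.height s t < Γ.height s' t
  · rcases lt_trichotomy (Γ.left s') t with h | h | h
    · rcases lt_trichotomy (Γ.right s') t with h' | h' | h'
      · simp [h.ne, h'.ne, h'.not_ge, h'.not_gt]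
      · simp [h.ne, h, h', hQ, CharTwo.add_self_eq_zero]
      · simp [h.ne, h, h', hQ, h'.ne', h'.le, h.le]
    · subst h
      simp [hlr, hlr.ne', hQ]
    · simp [h.ne', h.not_ge, h.not_gt, (h.trans hlr).ne']
  · simp [hQ]

theorem IsEven.numAbove_eq {C : S → ZMod 2} (hC : Γ.IsEven C) {s : S} {t t' : ℝ}
    (ht : t ∈ Set.Ioo (Γ.left s) (Γ.right s)) (ht' : t' ∈ Set.Ioo (Γ.left s) (Γ.right s)) :
    Γ.numAbove C s t = Γ.numAbove C s t' := by
  let : TopologicalSpace (ZMod 2) := ⊥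
  have : DiscreteTopology (ZMod 2) := ⟨rfl⟩
  refine isPreconnected_Ioo.constant (f := Γ.numAbove C s) (fun x hx => ?_) ht ht'
  refine ContinuousAt.continuousWithinAt (continuousAt_const.congr (f := fun _ =>
    Γ.numAbove C s x) ?_)
  have h : ∀ᶠ y in 𝓝[<] x ⊔ 𝓝[≥] x, Γ.numAbove C s y = Γ.numAbove C s x :=
    eventually_sup.2 ⟨hC.eventually_numAbove_left hx.1 hx.2, eventually_numAbove_right C hx.1 hx.2⟩
  rw [nhdsLT_sup_nhdsGE] at h
  exact h.mono fun y hy => hy.symm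

/-- Near its left end, `s` has above it the segments passing over that end and the steeper ones
leaving it. -/
theorem eventually_numAbove_left_end (C : S → ZMod 2) (s : S) :
    ∀ᶠ t in 𝓝[>] (Γ.left s), Γ.numAbove C s t =
      Γ.numOver C (Γ.left s) (Γ.height s (Γ.left s)) +
        ∑ s', if Γ.left s' = Γ.left s ∧ Γ.slope s < Γ.slope s' then C s' else 0 := by
  have key : ∀ s', ∀ᶠ t in 𝓝[>] (Γ.left s),
      (if Γ.left s' ≤ t ∧ t < Γ.right s' ∧ Γ.height s t < Γ.height s' t then C s' else 0) =
        (if Γ.left s' < Γ.left s ∧ Γ.left s < Γ.right s' ∧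
          Γ.height s (Γ.left s) < Γ.height s' (Γ.left s) then C s' else 0) +
        if Γ.left s' = Γ.left s ∧ Γ.slope s < Γ.slope s' then C s' else 0 := by
    intro s'
    rcases lt_trichotomy (Γ.left s) (Γ.left s') with hl | hl | hl
    · filter_upwards [mem_nhdsWithin_of_mem_nhds (Iio_mem_nhds hl)] with t ht
      rw [if_neg fun h => (not_le.2 ht) h.1, if_neg fun h => lt_asymm hl h.1,
        if_neg fun h => hl.ne' h.1, add_zero]
    · filter_upwards [self_mem_nhdsWithin, mem_nhdsWithin_of_mem_nhds
        (Iio_mem_nhds (hl ▸ Γ.left_lt_right s'))] with t ht1 ht2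
      have h0 : Γ.height s (Γ.left s) = Γ.height s' (Γ.left s) :=
        Γ.eq_of_end s s' _ (Or.inl rfl) (Or.inl hl.symm)
      have h1 := Γ.height_sub_height h0 t
      have h2 : 0 < t - Γ.left s := sub_pos.2 ht1
      have h3 : Γ.height s t < Γ.height s' t ↔ Γ.slope s < Γ.slope s' := by
        rw [← sub_pos, h1, mul_pos_iff_of_pos_right h2, sub_pos]
      have h4 : Γ.left s' ≤ t := hl ▸ (le_of_lt ht1)
      have h5 : t < Γ.right s' := ht2
      rw [if_neg (c := Γ.left s' < Γ.left s ∧ _) fun h => h.1.ne hl.symm, zero_add]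
      exact if_congr ⟨fun h => ⟨hl.symm, h3.1 h.2.2⟩, fun h => ⟨h4, h5, h3.2 h.2⟩⟩ rfl rfl
    · have hs : s' ≠ s := by
        rintro rfl
        exact lt_irrefl _ hl
      rw [if_neg (c := Γ.left s' = Γ.left s ∧ _) fun h => hl.ne h.1, add_zero]
      rcases le_or_gt (Γ.right s') (Γ.left s) with hr | hr
      · filter_upwards [self_mem_nhdsWithin] with t ht
        rw [if_neg fun h => (hr.trans_lt ht).not_gt h.2.1, if_neg fun h => hr.not_gt h.2.1]
      · filter_upwards [mem_nhdsWithin_of_mem_nhds (Iio_mem_nhds hr), self_mem_nhdsWithin,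
          mem_nhdsWithin_of_mem_nhds (Γ.eventually_height_lt_iff
            (Γ.height_ne hs hl hr le_rfl (Γ.left_lt_right s).le).symm)] with t ht1 ht2 ht3
        have h5 : Γ.left s' ≤ t := (hl.trans ht2).le
        have h6 : t < Γ.right s' := ht1
        have h7 : _ ↔ _ := ht3
        exact if_congr (by tauto) rfl rfl
  filter_upwards [eventually_all.2 key] with t ht
  rw [numAbove, numOver, ← Finset.sum_add_distrib]
  exact Finset.sum_congr rfl fun s' _ => ht s'

/-- The mirror image: to the left of a common end, smaller slope means higher. -/
theorem eventually_numAbove_right_end (C : S → ZMod 2) (s : S) :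
    ∀ᶠ t in 𝓝[<] (Γ.right s), Γ.numAbove C s t =
      Γ.numOver C (Γ.right s) (Γ.height s (Γ.right s)) +
        ∑ s', if Γ.right s' = Γ.right s ∧ Γ.slope s' < Γ.slope s then C s' else 0 := by
  have key : ∀ s', ∀ᶠ t in 𝓝[<] (Γ.right s),
      (if Γ.left s' ≤ t ∧ t < Γ.right s' ∧ Γ.height s t < Γ.height s' t then C s' else 0) =
        (if Γ.left s' < Γ.right s ∧ Γ.right s < Γ.right s' ∧
          Γ.height s (Γ.right s) < Γ.height s' (Γ.right s) then C s' else 0) +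
        if Γ.right s' = Γ.right s ∧ Γ.slope s' < Γ.slope s then C s' else 0 := by
    intro s'
    rcases lt_trichotomy (Γ.right s') (Γ.right s) with hl | hl | hl
    · filter_upwards [mem_nhdsWithin_of_mem_nhds (Ioi_mem_nhds hl)] with t ht
      rw [if_neg fun h => lt_asymm ht h.2.1, if_neg fun h => lt_asymm hl h.2.1,
        if_neg fun h => hl.ne h.1, add_zero]
    · filter_upwards [self_mem_nhdsWithin, mem_nhdsWithin_of_mem_nhds
        (Ioi_mem_nhds (hl ▸ Γ.left_lt_right s'))] with t ht1 ht2
      have h0 : Γ.height s (Γ.right s) = Γ.height s' (Γ.right s) :=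
        Γ.eq_of_end s s' _ (Or.inr rfl) (Or.inr hl)
      have h1 := Γ.height_sub_height h0 t
      have h2 : t - Γ.right s < 0 := sub_neg.2 ht1
      have h3 : Γ.height s t < Γ.height s' t ↔ Γ.slope s' < Γ.slope s := by
        rw [← sub_pos, h1, ← neg_mul_neg, mul_pos_iff_of_pos_right (neg_pos.2 h2), neg_sub, sub_pos]
      have h4 : Γ.left s' ≤ t := le_of_lt ht2
      have h5 : t < Γ.right s' := hl ▸ ht1
      rw [if_neg (c := Γ.left s' < Γ.right s ∧ _) fun h => h.2.1.ne hl.symm, zero_add]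
      exact if_congr ⟨fun h => ⟨hl, h3.1 h.2.2⟩, fun h => ⟨h4, h5, h3.2 h.2⟩⟩ rfl rfl
    · have hs : s' ≠ s := by
        rintro rfl
        exact lt_irrefl _ hl
      rw [if_neg (c := Γ.right s' = Γ.right s ∧ _) fun h => hl.ne' h.1, add_zero]
      rcases le_or_gt (Γ.right s) (Γ.left s') with hr | hr
      · filter_upwards [self_mem_nhdsWithin] with t ht
        rw [if_neg fun h => (lt_of_lt_of_le ht hr).not_ge h.1, if_neg fun h => hr.not_gt h.1]
      · filter_upwards [mem_nhdsWithin_of_mem_nhds (Ioi_mem_nhds hr), self_mem_nhdsWithin,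
          mem_nhdsWithin_of_mem_nhds (Γ.eventually_height_lt_iff
            (Γ.height_ne hs hr hl (Γ.left_lt_right s).le le_rfl).symm)] with t ht1 ht2 ht3
        have h5 : Γ.left s' ≤ t := le_of_lt ht1
        have h6 : t < Γ.right s' := lt_trans ht2 hl
        have h7 : _ ↔ _ := ht3
        exact if_congr (by tauto) rfl rfl
  filter_upwards [eventually_all.2 key] with t ht
  rw [numAbove, numOver, ← Finset.sum_add_distrib]
  exact Finset.sum_congr rfl fun s' _ => ht s'

variable (Γ)

/-- The label of the upper side of a segment: the winding numbers mod 2 around it. -/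
noncomputable def upper (s : S) (C : {C : S → ZMod 2 // Γ.IsEven C}) : ZMod 2 :=
  Γ.numAbove C.1 s ((Γ.left s + Γ.right s) / 2)

/-- The label of the lower side of a segment: the winding numbers mod 2 around it. -/
noncomputable def lower (s : S) (C : {C : S → ZMod 2 // Γ.IsEven C}) : ZMod 2 :=
  Γ.upper s C + C.1 s

theorem upper_eq_of_left {s : S} {t y : ℝ} (ht : Γ.left s = t) (hy : Γ.height s t = y) :
    Γ.upper s = (fun C : {C : S → ZMod 2 // Γ.IsEven C} => Γ.numOver C.1 t y) +
      ∑ s' ∈ (Finset.univ.filter fun s' => Γ.left s' = t) with Γ.slope s < Γ.slope s',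
        fun C : {C : S → ZMod 2 // Γ.IsEven C} => C.1 s' := by
  subst ht hy
  ext C
  have hlt := Γ.left_lt_right s
  obtain ⟨t, ht1, ht2⟩ := ((eventually_numAbove_left_end C.1 s).and
    (Ioo_mem_nhdsGT hlt)).exists
  rw [upper, C.2.numAbove_eq (t' := t) ⟨by linarith, by linarith⟩ ht2, ht1]
  rw [Pi.add_apply, Finset.sum_apply, Finset.filter_filter, Finset.sum_filter]

theorem upper_eq_of_right {s : S} {t y : ℝ} (ht : Γ.right s = t) (hy : Γ.height s t = y) :
    Γ.upper s = (fun C : {C : S → ZMod 2 // Γ.IsEven C} => Γ.numOver C.1 t y) +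
      ∑ s' ∈ (Finset.univ.filter fun s' => Γ.right s' = t) with -Γ.slope s < -Γ.slope s',
        fun C : {C : S → ZMod 2 // Γ.IsEven C} => C.1 s' := by
  subst ht hy
  ext C
  have hlt := Γ.left_lt_right s
  obtain ⟨t, ht1, ht2⟩ := ((eventually_numAbove_right_end C.1 s).and
    (Ioo_mem_nhdsLT hlt)).exists
  rw [upper, C.2.numAbove_eq (t' := t) ⟨by linarith, by linarith⟩ ht2, ht1]
  rw [Pi.add_apply, Finset.sum_apply, Finset.filter_filter, Finset.sum_filter]
  simp only [neg_lt_neg_iff]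

/-- The boundary of a face is even. -/
theorem isEven_boundary (f : {C : S → ZMod 2 // Γ.IsEven C} → ZMod 2) :
    Γ.IsEven fun s => (if Γ.upper s = f then 1 else 0) + (if Γ.lower s = f then 1 else 0) := by
  intro t
  by_cases h : ∃ s, Γ.left s = t ∨ Γ.right s = t
  swap
  · push Not at h
    exact Finset.sum_eq_zero fun s _ => by rw [if_neg (h s).1, if_neg (h s).2, add_zero]
  obtain ⟨s₀, hs₀⟩ := h
  set y := Γ.height s₀ t with hy
  have hy' : ∀ s, (Γ.left s = t ∨ Γ.right s = t) → Γ.height s t = y := fun s hs =>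
    Γ.eq_of_end s s₀ t hs hs₀
  let v : S → {C : S → ZMod 2 // Γ.IsEven C} → ZMod 2 := fun s C => C.1 s
  have hlow : ∀ s, Γ.lower s = Γ.upper s + v s := fun s => rfl
  set x : {C : S → ZMod 2 // Γ.IsEven C} → ZMod 2 := fun C => Γ.numOver C.1 t y with hx
  -- On each side of the point, the segments ending there are crossed from top to bottom, starting
  -- from the label `x` above the point; on the left this is the order of increasing slopes, hence
  -- the negated key. By evenness (`hRL`) both descents arrive at the same label below.
  have hR := sum_ite_partialSum_eq Γ.slope (Finset.univ.filter fun s => Γ.left s = t)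
    (fun a ha b hb hab => by
      by_contra hne
      simp only [Finset.coe_filter, Finset.mem_univ, true_and, Set.mem_ofPred_eq] at ha hb
      exact Γ.slope_ne_of_left_eq hne (ha.trans hb.symm) hab) v x f
  have hL := sum_ite_partialSum_eq (fun s => -Γ.slope s)
    (Finset.univ.filter fun s => Γ.right s = t)
    (fun a ha b hb hab => by
      by_contra hne
      simp only [Finset.coe_filter, Finset.mem_univ, true_and, Set.mem_ofPred_eq] at ha hb
      exact Γ.slope_ne_of_right_eq hne (ha.trans hb.symm) (neg_injective hab)) v x f
  have hRL : ∑ s ∈ Finset.univ.filter (fun s => Γ.left s = t), v s =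
      ∑ s ∈ Finset.univ.filter (fun s => Γ.right s = t), v s := by
    ext C
    have := C.2 t
    rw [Finset.sum_add_distrib, ← Finset.sum_filter, ← Finset.sum_filter,
      CharTwo.add_eq_zero] at this
    simpa [Finset.sum_apply, v] using this
  rw [Finset.sum_add_distrib, ← Finset.sum_filter, ← Finset.sum_filter, CharTwo.add_eq_zero]
  rw [← hRL, ← hR] at hL
  refine Eq.trans ?_ (hL.symm.trans ?_)
  · refine Finset.sum_congr rfl fun s hs => ?_
    have hs' : Γ.left s = t := (Finset.mem_filter.1 hs).2
    have hup : Γ.upper s = x + ∑ s' ∈ (Finset.univ.filter fun s' => Γ.left s' = t)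
        with Γ.slope s < Γ.slope s', v s' := Γ.upper_eq_of_left hs' (hy' s (Or.inl hs'))
    rw [hlow, hup]
  · refine Finset.sum_congr rfl fun s hs => ?_
    have hs' : Γ.right s = t := (Finset.mem_filter.1 hs).2
    have hup : Γ.upper s = x + ∑ s' ∈ (Finset.univ.filter fun s' => Γ.right s' = t)
        with -Γ.slope s < -Γ.slope s', v s' := Γ.upper_eq_of_right hs' (hy' s (Or.inr hs'))
    rw [hlow, hup]

end SegmentSystem

/-! ### Faces of plane systems of segments -/

/-- A finite set of points has distinct images under a generic linear functional. -/
theorem exists_injOn_add_mul {T : Set (ℝ × ℝ)} (hT : T.Finite) :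
    ∃ ε : ℝ, Set.InjOn (fun P : ℝ × ℝ => P.1 + ε * P.2) T := by
  -- The excluded values are those for which two of the points collide; pairs with equal ordinates
  -- only exclude the harmless value `0`.
  obtain ⟨ε, hε⟩ := ((hT.prod hT).image
    fun q : (ℝ × ℝ) × (ℝ × ℝ) => -(q.1.1 - q.2.1) / (q.1.2 - q.2.2)).exists_notMem
  refine ⟨ε, fun P hP Q hQ h => ?_⟩
  dsimp only at h
  by_cases h2 : P.2 = Q.2
  · refine Prod.ext ?_ h2
    rw [h2] at h
    exact add_right_cancel h
  · refine absurd ⟨(P, Q), ⟨hP, hQ⟩, ?_⟩ hε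
    have : P.2 - Q.2 ≠ 0 := sub_ne_zero.2 h2
    dsimp only
    rw [div_eq_iff this]
    linear_combination -h

open scoped Classical in
/-- A finite plane system of segments that meet only in common ends has a labelling of the sides of
the segments by faces: face boundaries are even, and any even function is the jump of a function
of the faces. -/
theorem exists_face_labelling.{u} {S : Type u} [Fintype S] (a b : S → ℝ × ℝ) (hab : ∀ s, a s ≠ b s)
    (hinter : ∀ s s', s ≠ s' → ∀ P ∈ segment ℝ (a s) (b s), P ∈ segment ℝ (a s') (b s') →
      P = a s ∨ P = b s) :
    ∃ (Λ : Type u) (_ : Fintype Λ) (_ : DecidableEq Λ) (u l : S → Λ),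
      (∀ f P, ∑ s, ((if a s = P then
          (if u s = f then (1 : ZMod 2) else 0) + (if l s = f then 1 else 0) else 0) +
        (if b s = P then
          (if u s = f then (1 : ZMod 2) else 0) + (if l s = f then 1 else 0) else 0)) = 0) ∧
      ∀ C : S → ZMod 2,
        (∀ P, ∑ s, ((if a s = P then C s else 0) + (if b s = P then C s else 0)) = 0) →
        ∃ w : Λ → ZMod 2, ∀ s, C s = w (u s) + w (l s) := by
  set T : Set (ℝ × ℝ) := Set.range a ∪ Set.range b with hT
  have haT : ∀ s, a s ∈ T := fun s => Or.inl ⟨s, rfl⟩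
  have hbT : ∀ s, b s ∈ T := fun s => Or.inr ⟨s, rfl⟩
  obtain ⟨ε, hε⟩ := exists_injOn_add_mul ((Set.finite_range a).union (Set.finite_range b))
  -- After this shear, distinct ends have distinct abscissas `X`; in particular no segment is
  -- vertical.
  set X : ℝ × ℝ → ℝ := fun P => P.1 + ε * P.2 with hX
  have hXne : ∀ s, X (b s) - X (a s) ≠ 0 := fun s =>
    sub_ne_zero.2 fun h => hab s (hε (haT s) (hbT s) h.symm)
  let m : S → ℝ := fun s => ((b s).2 - (a s).2) / (X (b s) - X (a s))
  let c : S → ℝ := fun s => (a s).2 - m s * X (a s)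
  have hm : ∀ s, m s * (X (b s) - X (a s)) = (b s).2 - (a s).2 := fun s =>
    div_mul_cancel₀ _ (hXne s)
  have hpt : ∀ s t, min (X (a s)) (X (b s)) ≤ t → t ≤ max (X (a s)) (X (b s)) →
      ∃ P ∈ segment ℝ (a s) (b s), X P = t ∧ P.2 = m s * t + c s := by
    intro s t h1 h2
    have hτ : (t - X (a s)) / (X (b s) - X (a s)) ∈ Set.Icc (0 : ℝ) 1 := by
      rcases (sub_ne_zero.1 (hXne s)).lt_or_gt with h | h
      · rw [min_eq_right h.le] at h1
        rw [max_eq_left h.le] at h2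
        refine ⟨div_nonneg_of_nonpos (by linarith) (by linarith), ?_⟩
        rw [div_le_one_of_neg (by linarith)]
        linarith
      · rw [min_eq_left h.le] at h1
        rw [max_eq_right h.le] at h2
        refine ⟨div_nonneg (by linarith) (by linarith), ?_⟩
        rw [div_le_one (by linarith)]
        linarith
    set τ := (t - X (a s)) / (X (b s) - X (a s)) with hτdef
    have hτt : τ * (X (b s) - X (a s)) = t - X (a s) := div_mul_cancel₀ _ (hXne s)
    refine ⟨AffineMap.lineMap (a s) (b s) τ, ?_, ?_, ?_⟩
    · rw [segment_eq_image_lineMap]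
      exact ⟨τ, hτ, rfl⟩
    · simp only [hX, AffineMap.lineMap_apply, vsub_eq_sub, vadd_eq_add, Prod.fst_add,
        Prod.snd_add, Prod.smul_fst, Prod.smul_snd, Prod.fst_sub, Prod.snd_sub, smul_eq_mul] at *
      linear_combination hτt
    · simp only [AffineMap.lineMap_apply, vsub_eq_sub, vadd_eq_add,
        Prod.snd_add, Prod.smul_snd, Prod.snd_sub, smul_eq_mul, c]
      linear_combination m s * hτt - τ * hm s
  have hend : ∀ s t, (min (X (a s)) (X (b s)) = t ∨ max (X (a s)) (X (b s)) = t) →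
      ∃ P ∈ T, X P = t ∧ m s * t + c s = P.2 := by
    intro s t h
    have h' : X (a s) = t ∨ X (b s) = t := by
      rcases le_total (X (a s)) (X (b s)) with hle | hle
      · simpa [hle] using h
      · simpa [hle] using h.symm
    rcases h' with rfl | rfl
    · exact ⟨a s, haT s, rfl, by simp only [c]; ring⟩
    · exact ⟨b s, hbT s, rfl, by simp only [c]; linear_combination hm s⟩
  let Γ : SegmentSystem S :=
    { left := fun s => min (X (a s)) (X (b s))
      right := fun s => max (X (a s)) (X (b s))
      slope := m
      intercept := c
      left_lt_right := fun s => min_lt_max.2 fun h => hXne s (by rw [h, sub_self])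
      eq_end_of_eq := by
        intro s s' hne t h1 h2 h3 h4 h
        obtain ⟨P, hP, hPX, hPy⟩ := hpt s t h1 h2
        obtain ⟨Q, hQ, hQX, hQy⟩ := hpt s' t h3 h4
        have hy : P.2 = Q.2 := hPy.trans (h.trans hQy.symm)
        have hPQ : P = Q := by
          refine Prod.ext ?_ hy
          have : P.1 + ε * P.2 = Q.1 + ε * Q.2 := hPX.trans hQX.symm
          rw [hy] at this
          exact add_right_cancel this
        have h5 : t = X (a s) ∨ t = X (b s) := by
          rcases hinter s s' hne P hP (hPQ ▸ hQ) with h | h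
          · exact Or.inl (by rw [← hPX, h])
          · exact Or.inr (by rw [← hPX, h])
        rcases le_total (X (a s)) (X (b s)) with hle | hle
        · simpa [hle] using h5
        · simpa [hle] using h5.symm
      eq_of_end := by
        intro s s' t h h'
        obtain ⟨P, hP, hPX, hPy⟩ := hend s t h
        obtain ⟨Q, hQ, hQX, hQy⟩ := hend s' t h'
        rw [hPy, hQy, hε hP hQ (hPX.trans hQX.symm)] }
  have hsum : ∀ (C : S → ZMod 2) t,
      ∑ s, ((if Γ.left s = t then C s else 0) + (if Γ.right s = t then C s else 0)) =
      ∑ s, ((if X (a s) = t then C s else 0) + (if X (b s) = t then C s else 0)) := by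
    intro C t
    refine Finset.sum_congr rfl fun s _ => ?_
    rcases le_total (X (a s)) (X (b s)) with hle | hle
    · simp only [Γ, min_eq_left hle, max_eq_right hle]
    · simp only [Γ, min_eq_right hle, max_eq_left hle]
      rw [add_comm]
  have hsumT : ∀ (C : S → ZMod 2), ∀ P ∈ T,
      ∑ s, ((if X (a s) = X P then C s else 0) + (if X (b s) = X P then C s else 0)) =
      ∑ s, ((if a s = P then C s else 0) + (if b s = P then C s else 0)) := by
    intro C P hP
    refine Finset.sum_congr rfl fun s _ => ?_
    congr 1
    · exact if_congr ⟨fun h => hε (haT s) hP h, fun h => by rw [h]⟩ rfl rfl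
    · exact if_congr ⟨fun h => hε (hbT s) hP h, fun h => by rw [h]⟩ rfl rfl
  refine ⟨_, inferInstance, inferInstance, Γ.upper, Γ.lower, fun f P => ?_, fun C hC => ?_⟩
  · by_cases hP : P ∈ T
    · rw [← hsumT _ P hP, ← hsum]
      exact Γ.isEven_boundary f (X P)
    · refine Finset.sum_eq_zero fun s _ => ?_
      rw [if_neg fun h : a s = P => hP (h ▸ haT s),
        if_neg fun h : b s = P => hP (h ▸ hbT s), add_zero]
  · have hCe : Γ.IsEven C := by
      intro t
      rw [hsum]
      by_cases ht : ∃ P ∈ T, X P = t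
      · obtain ⟨P, hP, rfl⟩ := ht
        rw [hsumT C P hP, hC P]
      · push Not at ht
        refine Finset.sum_eq_zero fun s _ => ?_
        rw [if_neg (ht _ (haT s)), if_neg (ht _ (hbT s)), add_zero]
    -- A label is a function of the even functions, so it can be evaluated at `C` itself.
    refine ⟨fun f => f ⟨C, hCe⟩, fun s => ?_⟩
    change C s = Γ.upper s ⟨C, hCe⟩ + (Γ.upper s ⟨C, hCe⟩ + C s)
    rw [← add_assoc, CharTwo.add_self_eq_zero, zero_add]

/-! ### Faces of plane drawings -/

/-- A vertex of a polygonal arc lies only on the segments that end in it. -/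
theorem eq_or_eq_of_mem_segment_of_chain {k : ℕ} {p : ℕ → ℝ × ℝ} (hne : ∀ i < k, p i ≠ p (i + 1))
    (hcons : ∀ i, i + 1 < k →
      segment ℝ (p i) (p (i + 1)) ∩ segment ℝ (p (i + 1)) (p (i + 2)) = {p (i + 1)})
    (hdisj : ∀ i j, i + 1 < j → j < k →
      Disjoint (segment ℝ (p i) (p (i + 1))) (segment ℝ (p j) (p (j + 1))))
    {i j : ℕ} (hi : i < k) (hj : j ≤ k) (h : p j ∈ segment ℝ (p i) (p (i + 1))) :
    j = i ∨ j = i + 1 := by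
  by_contra hcon
  push Not at hcon
  rcases lt_or_ge j i with hji | hji
  · have hmem : p j ∈ segment ℝ (p j) (p (j + 1)) := left_mem_segment _ _ _
    rcases Nat.lt_or_ge (j + 1) i with h1 | h1
    · exact Set.disjoint_left.1 (hdisj j i h1 hi) hmem h
    · obtain rfl : i = j + 1 := by omega
      have := (hcons j hi).subset ⟨hmem, h⟩
      exact hne j (by omega) this
  · obtain ⟨j, rfl⟩ : ∃ l, j = l + 1 := ⟨j - 1, by omega⟩
    have hmem : p (j + 1) ∈ segment ℝ (p j) (p (j + 1)) := right_mem_segment _ _ _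
    rcases Nat.lt_or_ge (i + 1) j with h1 | h1
    · exact Set.disjoint_left.1 (hdisj i j h1 (by omega)) h hmem
    · obtain rfl : j = i + 1 := by omega
      have := (hcons i (by omega)).subset ⟨h, hmem⟩
      exact hne (i + 1) (by omega) this.symm

theorem sum_ends_of_chain {Q : Type*} [DecidableEq Q] (k : ℕ) (p : ℕ → Q) (P : Q) (c : ZMod 2) :
    ∑ i : Fin k, ((if p i = P then c else 0) + (if p (i + 1) = P then c else 0)) =
      (if p 0 = P then c else 0) + (if p k = P then c else 0) := by
  rw [Fin.sum_univ_eq_sum_range (fun i => (if p i = P then c else 0) +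
    (if p (i + 1) = P then c else 0))]
  induction k with
  | zero => simp [CharTwo.add_self_eq_zero]
  | succ k ih =>
    rw [Finset.sum_range_succ, ih]
    have := CharTwo.add_self_eq_zero (if p k = P then c else 0)
    linear_combination this

namespace SimpleGraph

variable {V : Type*} [Fintype V] {G : SimpleGraph V}

/-- In a planar graph the edges have a labelling of their two sides by faces: face boundaries are in
the cycle space, and each element of the cycle space is the jump of a function of the faces. -/
theorem IsPlanar.exists_face_labelling.{u} {V : Type u} [Fintype V] {G : SimpleGraph V}
    (hG : G.IsPlanar) :
    ∃ (Λ : Type u) (_ : Fintype Λ) (_ : DecidableEq Λ) (u l : G.edgeSet → Λ),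
      (∀ f, (fun e => (if u e = f then (1 : ZMod 2) else 0) + (if l e = f then 1 else 0)) ∈
        G.cycleSpace) ∧
      ∀ C ∈ G.cycleSpace, ∃ w : Λ → ZMod 2, ∀ e, C e = w (u e) + w (l e) := by
  classical
  obtain ⟨𝒟⟩ := hG
  have hex : ∀ e : G.edgeSet, ∃ (x y : V) (k : ℕ) (p : ℕ → ℝ × ℝ), e.1 = s(x, y) ∧ 1 ≤ k ∧
      p 0 = 𝒟.point x ∧ p k = 𝒟.point y ∧
      𝒟.arc e.1 = ⋃ i ∈ Set.Iio k, segment ℝ (p i) (p (i + 1)) ∧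
      (∀ i < k, p i ≠ p (i + 1)) ∧
      (∀ i, i + 1 < k →
        segment ℝ (p i) (p (i + 1)) ∩ segment ℝ (p (i + 1)) (p (i + 2)) = {p (i + 1)}) ∧
      (∀ i j, i + 1 < j → j < k →
        Disjoint (segment ℝ (p i) (p (i + 1))) (segment ℝ (p j) (p (j + 1)))) := by
    rintro ⟨e, he⟩
    induction e with
    | _ x y =>
      obtain ⟨k, p, h⟩ := 𝒟.isPolygonalArc x y he
      exact ⟨x, y, k, p, rfl, h⟩
  choose x y k p hxy hk hp0 hpk harc hne hcons hdisj using hex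
  have hseg : ∀ e i, i < k e → ∀ P ∈ segment ℝ (p e i) (p e (i + 1)), P ∈ 𝒟.arc e.1 := by
    intro e i hi P hP
    rw [harc]
    exact Set.mem_biUnion hi hP
  have hchain : ∀ e {i j}, i < k e → j ≤ k e → p e j ∈ segment ℝ (p e i) (p e (i + 1)) →
      j = i ∨ j = i + 1 := fun e i j hi hj h =>
    eq_or_eq_of_mem_segment_of_chain (hne e) (hcons e) (hdisj e) hi hj h
  have hinj : ∀ e {i j}, i ≤ k e → j ≤ k e → p e i = p e j → i = j := by
    have hlt : ∀ e {i j}, i < j → j ≤ k e → p e i ≠ p e j := by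
      intro e i j hij hj h
      rcases hchain e (hij.trans_le hj) hj (h ▸ left_mem_segment _ _ _) with h1 | h1
      · omega
      · exact hne e i (by omega) (h1 ▸ h)
    intro e i j hi hj h
    rcases lt_trichotomy i j with h1 | h1 | h1
    · exact absurd h (hlt e h1 hj)
    · exact h1
    · exact absurd h.symm (hlt e h1 hi)
  have hmem : ∀ e w, w ∈ e.1 → 𝒟.point w = p e 0 ∨ 𝒟.point w = p e (k e) := by
    intro e w hw
    rw [hxy, Sym2.mem_iff] at hw
    rcases hw with rfl | rfl
    · exact Or.inl (hp0 e).symm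
    · exact Or.inr (hpk e).symm
  let S := Σ e : G.edgeSet, Fin (k e)
  let a : S → ℝ × ℝ := fun s => p s.1 s.2
  let b : S → ℝ × ℝ := fun s => p s.1 (s.2 + 1)
  have hinter : ∀ s s', s ≠ s' → ∀ P ∈ segment ℝ (a s) (b s), P ∈ segment ℝ (a s') (b s') →
      P = a s ∨ P = b s := by
    rintro ⟨e, i⟩ ⟨e', i'⟩ hss P hP hP'
    by_cases hee : e = e'
    · subst hee
      have hii : (i : ℕ) ≠ i' := fun h => hss (by rw [Fin.ext h])
      rcases hii.lt_or_gt with h | h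
      · rcases Nat.lt_or_ge (i + 1) i' with h1 | h1
        · exact absurd hP' (Set.disjoint_left.1 (hdisj e i i' h1 i'.2) hP)
        · have h2 : (i' : ℕ) = i + 1 := by omega
          simp only [a, b, h2] at hP hP'
          exact Or.inr ((hcons e i (h2 ▸ i'.2)).subset ⟨hP, hP'⟩)
      · rcases Nat.lt_or_ge (i' + 1) i with h1 | h1
        · exact absurd hP (Set.disjoint_left.1 (hdisj e i' i h1 i.2) hP')
        · have h2 : (i : ℕ) = i' + 1 := by omega
          simp only [a, b, h2] at hP hP' ⊢
          exact Or.inl ((hcons e i' (h2 ▸ i.2)).subset ⟨hP', hP⟩)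
    · obtain ⟨w, ⟨hw, -⟩, rfl⟩ := 𝒟.arc_inter_arc e.1 e.2 e'.1 e'.2
        (fun h => hee (Subtype.ext h)) ⟨hseg e i i.2 P hP, hseg e' i' i'.2 P hP'⟩
      rcases hmem e w hw with h | h
      · rw [h] at hP ⊢
        rcases hchain e i.2 (Nat.zero_le _) hP with h1 | h1
        · left; simp only [a]; rw [← h1]
        · right; simp only [b]; rw [← h1]
      · rw [h] at hP ⊢
        rcases hchain e i.2 le_rfl hP with h1 | h1
        · left; simp only [a]; rw [← h1]
        · right; simp only [b]; rw [← h1]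
  obtain ⟨Λ, hΛ, hΛ', u, l, hul, hw⟩ :=
    _root_.exists_face_labelling a b (fun s => hne s.1 s.2 s.2.2) hinter
  have hconst : ∀ (z : G.edgeSet → ZMod 2) P,
      ∑ s : S, ((if a s = P then z s.1 else 0) + (if b s = P then z s.1 else 0)) =
      ∑ e : G.edgeSet, ((if p e 0 = P then z e else 0) + (if p e (k e) = P then z e else 0)) := by
    intro z P
    rw [Fintype.sum_sigma]
    exact Finset.sum_congr rfl fun e _ => sum_ends_of_chain (k e) (p e) P (z e)
  have hpoint : ∀ (z : G.edgeSet → ZMod 2) v,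
      ∑ s : S, ((if a s = 𝒟.point v then z s.1 else 0) +
        (if b s = 𝒟.point v then z s.1 else 0)) = G.incidenceSum z v := by
    intro z v
    rw [hconst, incidenceSum_apply]
    refine Finset.sum_congr rfl fun e _ => ?_
    have hxy' : x e ≠ y e := G.ne_of_adj (by rw [← mem_edgeSet, ← hxy]; exact e.2)
    have hve : v ∈ e.1 ↔ v = x e ∨ v = y e := by
      rw [← Sym2.mem_iff, ← hxy]
    simp only [hp0, hpk, 𝒟.point_injective.eq_iff, hve]
    by_cases h1 : v = x e
    · subst h1
      simp [hxy'.symm]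
    · by_cases h2 : v = y e
      · subst h2
        simp [hxy']
      · simp [h1, h2, Ne.symm h1, Ne.symm h2]
  refine ⟨Λ, hΛ, hΛ', fun e => u ⟨e, 0, hk e⟩, fun e => l ⟨e, 0, hk e⟩, fun f => ?_,
    fun C hC => ?_⟩
  · set d : S → ZMod 2 := fun s => (if u s = f then (1 : ZMod 2) else 0) +
      (if l s = f then 1 else 0) with hd
    -- Only two segments end in an inner vertex of an arc, so evenness there forces equal values of
    -- `d`. The labels themselves may swap sides along the arc, but `d` is symmetric in the two
    -- sides, so the first segment can stand for the edge.
    have hstep : ∀ e i (hi : i + 1 < k e), d ⟨e, i + 1, hi⟩ = d ⟨e, i, by omega⟩ := by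
      intro e i hi
      have h0 := hul f (p e (i + 1))
      change ∑ s : S, ((if a s = p e (i + 1) then d s else 0) +
        (if b s = p e (i + 1) then d s else 0)) = 0 at h0
      rw [Fintype.sum_sigma, Finset.sum_eq_single e, Finset.sum_add_distrib,
        Finset.sum_eq_single (⟨i + 1, hi⟩ : Fin (k e)),
        Finset.sum_eq_single (⟨i, by omega⟩ : Fin (k e))] at h0
      · simp only [a, b, if_true] at h0
        exact CharTwo.add_eq_zero.1 h0
      · intro j _ hj
        refine if_neg fun h => hj (Fin.ext ?_)
        have := hinj e j.2 hi.le h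
        simpa using this
      · simp
      · intro j _ hj
        refine if_neg fun h => hj (Fin.ext ?_)
        exact hinj e j.2.le hi.le h
      · simp
      · intro e' _ hee
        refine Finset.sum_eq_zero fun j _ => ?_
        have hno : p e (i + 1) ∉ segment ℝ (p e' j) (p e' (j + 1)) := by
          intro hmem'
          obtain ⟨w, ⟨hwe, -⟩, hwP⟩ := 𝒟.arc_inter_arc e.1 e.2 e'.1 e'.2
            (fun h => hee (Subtype.ext h.symm))
            ⟨hseg e i (by omega) _ (right_mem_segment _ _ _), hseg e' j j.2 _ hmem'⟩
          rcases hmem e w hwe with h | h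
          · have := hinj e hi.le (Nat.zero_le _) (hwP.symm.trans h)
            omega
          · have := hinj e hi.le le_rfl (hwP.symm.trans h)
            omega
        have ha : a ⟨e', j⟩ ≠ p e (i + 1) := fun h => hno (h ▸ left_mem_segment _ _ _)
        have hb : b ⟨e', j⟩ ≠ p e (i + 1) := fun h => hno (h ▸ right_mem_segment _ _ _)
        rw [if_neg ha, if_neg hb, add_zero]
      · simp
    have hd0 : ∀ s : S, d s = d ⟨s.1, 0, hk s.1⟩ := by
      rintro ⟨e, i, hi⟩
      induction i with
      | zero => rfl
      | succ i ih => rw [hstep e i hi]; exact ih _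
    rw [mem_cycleSpace]
    intro v
    rw [← hpoint]
    refine Eq.trans (Finset.sum_congr rfl fun s _ => ?_) (hul f (𝒟.point v))
    have := hd0 s
    simp only [hd] at this
    rw [this]
  -- Spreading `C` over the segments of each arc keeps it even, since inner vertices of an arc
  -- cancel.
  · refine (hw (fun s => C s.1) fun P => ?_).imp fun w hw e => hw ⟨e, 0, hk e⟩
    by_cases hP : ∃ v, 𝒟.point v = P
    · obtain ⟨v, rfl⟩ := hP
      rw [hpoint]
      exact G.mem_cycleSpace.1 hC v
    · push Not at hP
      rw [hconst]
      refine Finset.sum_eq_zero fun e _ => ?_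
      rw [hp0, hpk, if_neg (hP _), if_neg (hP _), add_zero]

/-- The dimension of the cycle space of a planar graph is bounded in terms of its girth. -/
theorem IsPlanar.mul_finrank_cycleSpace_le (hG : G.IsPlanar) {g : ℕ} (hg : g ≤ G.egirth) :
    g * Module.finrank (ZMod 2) G.cycleSpace ≤ 2 * G.edgeSet.ncard := by
  classical
  obtain ⟨Λ, _, _, u, l, hul, hw⟩ := hG.exists_face_labelling
  have h : G.edgeSet.ncard = Fintype.card G.edgeSet := by
    rw [← Nat.card_eq_fintype_card, Nat.card_coe_set_eq]
  rw [h]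
  refine mul_finrank_le_of_double_cover G.cycleSpace u l hul hw g fun z hz hne => ?_
  have := G.le_card_of_mem_cycleSpace hg hz hne
  rwa [Set.ncard_eq_toFinset_card', Set.toFinset_ofPred] at this

end SimpleGraph

/-! ### Two vertices of low degree, and the theorem -/

namespace SimpleGraph

variable {V : Type*} {G H : SimpleGraph V}

theorem IsPlanar.mono (hG : G.IsPlanar) (h : H ≤ G) : H.IsPlanar := by
  obtain ⟨𝒟⟩ := hG
  have he : H.edgeSet ⊆ G.edgeSet := edgeSet_mono h
  exact ⟨⟨𝒟.point, 𝒟.arc, 𝒟.point_injective, fun u v huv => 𝒟.isPolygonalArc u v (h huv),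
    fun e hee => 𝒟.mem_of_point_mem_arc e (he hee),
    fun e hee f hf => 𝒟.arc_inter_arc e (he hee) f (he hf)⟩⟩

/-- A planar graph of girth at least six with an edge has two non-isolated vertices of degree at most
two. -/
theorem IsPlanar.exists_ncard_neighborSet_le_two [Finite V] (hG : G.IsPlanar) (hg : 6 ≤ G.egirth)
    (hne : G ≠ ⊥) : ∃ u ∈ G.support, ∃ v ∈ G.support, u ≠ v ∧ (G.neighborSet u).ncard ≤ 2 ∧
      (G.neighborSet v).ncard ≤ 2 := by
  classical
  have := Fintype.ofFinite V
  have h1 : 6 * _ ≤ _ := hG.mul_finrank_cycleSpace_le (g := 6) hg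
  have h2 := G.card_edgeSet_lt_finrank_cycleSpace_add hne
  have hdeg : ∀ v, (G.neighborSet v).ncard = G.degree v := fun v => by
    rw [← Nat.card_coe_set_eq, Nat.card_eq_fintype_card, card_neighborSet_eq_degree]
  have h3 : ∑ v ∈ G.support.toFinset, G.degree v = 2 * G.edgeSet.ncard := by
    rw [Set.ncard_eq_toFinset_card', ← edgeFinset, ← G.sum_degrees_eq_twice_card_edges]
    refine Finset.sum_subset (Finset.subset_univ _) fun v _ hv => ?_
    rw [Set.mem_toFinset] at hv
    by_contra h0
    obtain ⟨w, hw⟩ := (G.degree_pos_iff_exists_adj v).1 (Nat.pos_of_ne_zero h0)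
    exact hv ⟨w, hw⟩
  have hpos : ∀ v ∈ G.support, 1 ≤ G.degree v := by
    rintro v ⟨w, hw⟩
    exact (G.degree_pos_iff_exists_adj v).2 ⟨w, hw⟩
  by_contra hcon
  push Not at hcon
  simp only [hdeg] at hcon
  -- A single exceptional vertex still has degree at least one, so it falls short of three by at
  -- most two. Against this, `h1` and `h2` give `2m + 3 ≤ 3n`.
  have h4 : 3 * G.support.ncard ≤ 2 * G.edgeSet.ncard + 2 := by
    rw [Set.ncard_eq_toFinset_card', mul_comm, ← smul_eq_mul, ← Finset.sum_const, ← h3]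
    by_cases hlow : ∃ v₀ ∈ G.support, G.degree v₀ ≤ 2
    · obtain ⟨v₀, hv₀, hd₀⟩ := hlow
      calc ∑ v ∈ G.support.toFinset, 3
          ≤ ∑ v ∈ G.support.toFinset, (G.degree v + if v₀ = v then 2 else 0) := by
            refine Finset.sum_le_sum fun v hv => ?_
            rw [Set.mem_toFinset] at hv
            split_ifs with h
            · have := hpos v hv
              omega
            · exact hcon v₀ hv₀ v hv h hd₀
        _ = _ := by
            rw [Finset.sum_add_distrib, Finset.sum_ite_eq, if_pos (Set.mem_toFinset.2 hv₀)]
    · push Not at hlow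
      refine (Finset.sum_le_sum fun v hv => ?_).trans (Nat.le_add_right _ 2)
      exact hlow v (Set.mem_toFinset.1 hv)
  omega

end SimpleGraph

theorem mainTheorem5 {V : Type*} [Finite V] (G : SimpleGraph V)
    (hconn : G.Connected) (hplanar : G.IsPlanar) (hgirth : 6 ≤ G.egirth) :
    G.IsGallai := by
  refine SimpleGraph.isGallai_of_forall_le (le_trans (by norm_num) hgirth) fun H hHG hH => ?_
  obtain ⟨x, y, hxy⟩ := H.ne_bot_iff_exists_adj.1 hH
  -- `K` keeps only the edges of the component of `x` in `H`, so its non-isolated vertices are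
  -- connected in `H` and have the same neighbours there.
  let K : SimpleGraph V :=
    { Adj := fun a b => H.Adj a b ∧ H.Reachable x a
      symm := ⟨fun a b h => ⟨h.1.symm, h.2.trans h.1.reachable⟩⟩
      loopless := ⟨fun a h => h.1.ne rfl⟩ }
  have hKG : K ≤ G := fun a b h => hHG h.1
  have hK : K ≠ ⊥ := K.ne_bot_iff_exists_adj.2 ⟨x, y, hxy, .refl x⟩
  obtain ⟨u, hu, v, hv, huv, hdu, hdv⟩ := (hplanar.mono hKG).exists_ncard_neighborSet_le_two
    (hgirth.trans (SimpleGraph.egirth_anti hKG)) hK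
  have hreach : ∀ a ∈ K.support, H.Reachable x a := fun a ⟨_, h⟩ => h.2
  have hnbr : ∀ a ∈ K.support, K.neighborSet a = H.neighborSet a := fun a ha =>
    Set.ext fun b => ⟨fun h => h.1, fun h => ⟨h, hreach a ha⟩⟩
  exact ⟨u, v, huv, (hreach u hu).symm.trans (hreach v hv), hnbr u hu ▸ hdu, hnbr v hv ▸ hdv⟩
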